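/- Let $d\ge 1$, and equip $\mathbb R^d$ with the Euclidean norm $|\cdot|$ and Lebesgue measure $\lambda$. A set $P\subseteq\mathbb R^d$ is called a \emph{polyhedron} if its boundary $\partial P$ can be covered by finitely many hyperplanes. A bounded set $A\subseteq\mathbb R^d$ is \emph{distance Kolmogorov} if for every $\varepsilon>0$ there is a 1-Lipschitz map $f:A\to\mathbb R^d$ such that $f(A)$ is a polyhedron and $|f(x)-x|\le\varepsilon$ for every $x\in A$. A bounded Lebesgue measurable set $A\subseteq\mathbb R^d$ is \emph{measure Kolmogorov} if for every $\varepsilon>0$ there is a 1-Lipschitz map $f:A\to\mathbb R^d$ such that $f(A)$ is a polyhedron and $\lambda(f(A))>\lambda(A)-\varepsilon$. A \emph{convex hypersurface} is a relatively open subset (possibly all) of the boundary $\partial C$ of a convex set $C\subseteq\mathbb R^d$ with nonempty interior. A \emph{regular $\mathcal C^2$ hypersurface} is a set $F(U)$, where $U\subseteq\mathbb R^{d-1}$ is open and $F:U\to\mathbb R^d$ is a $\mathcal C^2$ map whose derivative has rank $d-1$ at every point of $U$. \textbf{Corollary.} Let $A\subseteq\mathbb R^d$ be a bounded set whose boundary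 $\partial A$ can be covered by countably many sets, each of which is a convex hypersurface or a regular $\mathcal C^2$ hypersurface. Then $A$ is (Lebesgue measurable and) both distance Kolmogorov and measure Kolmogorov. -/

import Mathlib

open MeasureTheory

/-- A hyperplane in `ℝ^d`: the solution set of `⟪v, x⟫ = c` with `v ≠ 0`. -/
def IsHyperplane {d : ℕ} (H : Set (EuclideanSpace ℝ (Fin d))) : Prop :=
  ∃ (v : EuclideanSpace ℝ (Fin d)) (c : ℝ), v ≠ 0 ∧ H = {x | inner ℝ v x = c}

/-- A set is a polyhedron if its boundary is covered by finitely many hyperplanes. -/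
def IsPolyhedron {d : ℕ} (P : Set (EuclideanSpace ℝ (Fin d))) : Prop :=
  ∃ 𝓗 : Set (Set (EuclideanSpace ℝ (Fin d))),
    𝓗.Finite ∧ (∀ H ∈ 𝓗, IsHyperplane H) ∧ frontier P ⊆ ⋃₀ 𝓗

/-- Distance Kolmogorov sets: bounded sets that can be mapped onto a polyhedron by a 1-Lipschitz
map with arbitrarily small displacements. -/
def IsDistanceKolmogorov {d : ℕ} (A : Set (EuclideanSpace ℝ (Fin d))) : Prop :=
  Bornology.IsBounded A ∧
    ∀ ε : ℝ, 0 < ε → ∃ f : A → EuclideanSpace ℝ (Fin d),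
      LipschitzWith 1 f ∧ IsPolyhedron (Set.range f) ∧ ∀ x : A, ‖f x - (x : EuclideanSpace ℝ (Fin d))‖ ≤ ε

/-- Measure Kolmogorov sets: bounded Lebesgue measurable sets that can be mapped onto a polyhedron
by a 1-Lipschitz map with arbitrarily small measure loss. The inequality
`λ(f(A)) > λ(A) - ε` is written additively, so that no truncated subtraction occurs. -/
def IsMeasureKolmogorov {d : ℕ} (A : Set (EuclideanSpace ℝ (Fin d))) : Prop :=
  Bornology.IsBounded A ∧ NullMeasurableSet A volume ∧
    ∀ ε : ℝ, 0 < ε → ∃ f : A → EuclideanSpace ℝ (Fin d),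
      LipschitzWith 1 f ∧ IsPolyhedron (Set.range f) ∧
        volume A < volume (Set.range f) + ENNReal.ofReal ε

/-- A convex hypersurface: a relatively open part (possibly all) of the boundary of a convex set
with nonempty interior. The convex set may be unbounded. -/
def IsConvexHypersurface {d : ℕ} (M : Set (EuclideanSpace ℝ (Fin d))) : Prop :=
  ∃ C O : Set (EuclideanSpace ℝ (Fin d)),
    Convex ℝ C ∧ (interior C).Nonempty ∧ IsOpen O ∧ M = O ∩ frontier C

/-- A regular `C²` hypersurface: the image `F(U)` of an open set `U ⊆ ℝ^(d-1)` under a `C²` map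
`F` whose derivative has rank `d - 1` at every point of `U` (used for `d ≥ 1`). -/
def IsRegularC2Hypersurface {d : ℕ} (M : Set (EuclideanSpace ℝ (Fin d))) : Prop :=
  ∃ (U : Set (EuclideanSpace ℝ (Fin (d - 1))))
    (F : EuclideanSpace ℝ (Fin (d - 1)) → EuclideanSpace ℝ (Fin d)),
    IsOpen U ∧ ContDiffOn ℝ 2 F U ∧
      (∀ x ∈ U, Module.finrank ℝ (LinearMap.range (fderiv ℝ F x).toLinearMap) = d - 1) ∧
      M = F '' U

/-! The maps come from proximal maps `h = (I + ∂φ)⁻¹`, where `φ` is a maximum of finitely many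
affine functions with gradients of norm at most `ε`. Such an `h` is 1-Lipschitz and surjective and
moves points by at most `ε`. Either `h x` lies on a hyperplane where two pieces with different
gradients tie, or `h` moves `x` by minus the gradient of an active piece. Hence `h` flattens a
compact set `K` with a neighbourhood once no piece `i` is active at `x - a i`, for `x ∈ K`. Suitable
`φ` exist for compact parts of convex boundaries and for small pieces of `C²` hypersurfaces
(`isSqueezable_of_forall_exists_affine`). Squeezes compose and keep flat sets flat, so countably
many pieces can be treated in turn with summable displacements; compactness of `∂A` makes finitely
many steps suffice. Once `f(∂A)` is flat, `f(A)` is a polyhedron, because away from a flat set `f`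
is locally a translation of interior points. Surjectivity and small displacement keep a compact `Q ⊆
interior A` inside `f(A)`, which controls the measure. -/

/-- A set covered by finitely many hyperplanes. -/
def IsFlat {d : ℕ} (S : Set (EuclideanSpace ℝ (Fin d))) : Prop :=
  ∃ 𝓗 : Set (Set (EuclideanSpace ℝ (Fin d))),
    𝓗.Finite ∧ (∀ H ∈ 𝓗, IsHyperplane H) ∧ S ⊆ ⋃₀ 𝓗

namespace IsFlat

variable {d : ℕ} {S T : Set (EuclideanSpace ℝ (Fin d))}

theorem mono (hT : IsFlat T) (h : S ⊆ T) : IsFlat S := by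
  obtain ⟨𝓗, hf, hH, hc⟩ := hT
  exact ⟨𝓗, hf, hH, h.trans hc⟩

theorem empty : IsFlat (∅ : Set (EuclideanSpace ℝ (Fin d))) :=
  ⟨∅, Set.finite_empty, by simp, by simp⟩

theorem union (hS : IsFlat S) (hT : IsFlat T) : IsFlat (S ∪ T) := by
  obtain ⟨𝓗, hf, hH, hc⟩ := hS
  obtain ⟨𝓗', hf', hH', hc'⟩ := hT
  refine ⟨𝓗 ∪ 𝓗', hf.union hf', fun H h => h.elim (hH H) (hH' H), ?_⟩
  rw [Set.sUnion_union]
  exact Set.union_subset_union hc hc'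

theorem biUnion {ι : Type*} {s : Set ι} (hs : s.Finite)
    {F : ι → Set (EuclideanSpace ℝ (Fin d))} (hF : ∀ i ∈ s, IsFlat (F i)) :
    IsFlat (⋃ i ∈ s, F i) := by
  induction s, hs using Set.Finite.induction_on with
  | empty => simpa using empty
  | insert _ _ ih =>
    rw [Set.biUnion_insert]
    exact (hF _ (Set.mem_insert _ _)).union (ih fun i hi => hF i (Set.mem_insert_of_mem _ hi))

theorem of_isHyperplane (hS : IsHyperplane S) : IsFlat S :=
  ⟨{S}, Set.finite_singleton S, by simpa using hS, by simp⟩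

theorem image_add_right (hS : IsFlat S) (v : EuclideanSpace ℝ (Fin d)) :
    IsFlat ((fun x => x + v) '' S) := by
  obtain ⟨𝓗, hf, hH, hc⟩ := hS
  refine ⟨(fun H => (fun x => x + v) '' H) '' 𝓗, hf.image _, ?_, ?_⟩
  · rintro _ ⟨H, hH', rfl⟩
    obtain ⟨w, c, hw, rfl⟩ := hH H hH'
    refine ⟨w, c + inner ℝ w v, hw, ?_⟩
    ext x
    constructor
    · rintro ⟨y, hy, rfl⟩
      simp only [Set.mem_ofPred_eq] at hy ⊢
      rw [inner_add_right, hy]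
    · intro hx
      refine ⟨x - v, ?_, by simp⟩
      simp only [Set.mem_ofPred_eq] at hx ⊢
      rw [inner_sub_right, hx]
      ring
  · rintro _ ⟨x, hx, rfl⟩
    obtain ⟨H, hH', hxH⟩ := hc hx
    exact ⟨_, ⟨H, hH', rfl⟩, x, hxH, rfl⟩

theorem exists_isClosed_superset (hS : IsFlat S) : ∃ Z, S ⊆ Z ∧ IsClosed Z ∧ IsFlat Z := by
  obtain ⟨𝓗, hf, hH, hc⟩ := hS
  refine ⟨⋃₀ 𝓗, hc, ?_, 𝓗, hf, hH, subset_rfl⟩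
  rw [Set.sUnion_eq_biUnion]
  refine hf.isClosed_biUnion fun H hH' => ?_
  obtain ⟨w, c, -, rfl⟩ := hH H hH'
  exact isClosed_eq (by fun_prop) continuous_const

end IsFlat

/-! ### Squeezes and their composition -/

/-- A 1-Lipschitz surjection that acts by finitely many translations, up to a part of the space
that is mapped into finitely many hyperplanes. -/
def IsSqueeze {d : ℕ} (f : EuclideanSpace ℝ (Fin d) → EuclideanSpace ℝ (Fin d)) : Prop :=
  LipschitzWith 1 f ∧ Function.Surjective f ∧
    ∃ T : Set (EuclideanSpace ℝ (Fin d)), T.Finite ∧ IsFlat (f '' {x | f x - x ∉ T})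

namespace IsSqueeze

variable {d : ℕ} {f g : EuclideanSpace ℝ (Fin d) → EuclideanSpace ℝ (Fin d)}

theorem id : IsSqueeze (fun x : EuclideanSpace ℝ (Fin d) => x) :=
  ⟨LipschitzWith.id, Function.surjective_id, {0}, Set.finite_singleton 0, by
    simpa using IsFlat.empty⟩

/-- Each image point lies in the flat exceptional image or in one of finitely many translates of
`S`. Later squeezes therefore never undo a flattening. -/
theorem isFlat_image (hf : IsSqueeze f) {S : Set (EuclideanSpace ℝ (Fin d))} (hS : IsFlat S) :
    IsFlat (f '' S) := by
  obtain ⟨-, -, T, hT, hfl⟩ := hf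
  refine (hfl.union (IsFlat.biUnion hT fun t _ => hS.image_add_right t)).mono ?_
  rintro _ ⟨x, hx, rfl⟩
  by_cases h : f x - x ∈ T
  · right
    simp only [Set.mem_iUnion]
    exact ⟨_, h, x, hx, by simp⟩
  · exact Or.inl ⟨x, h, rfl⟩

theorem comp (hg : IsSqueeze g) (hf : IsSqueeze f) : IsSqueeze (fun x => g (f x)) := by
  have hg' := hg
  obtain ⟨gl, gs, T, hT, hgT⟩ := hg
  obtain ⟨fl, fs, T', hT', hfT⟩ := hf
  refine ⟨by simpa using! gl.comp fl, gs.comp fs, (fun p => p.1 + p.2) '' (T ×ˢ T'),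
    (hT.prod hT').image _, ?_⟩
  refine (hgT.union (hg'.isFlat_image hfT)).mono ?_
  rintro _ ⟨x, hx, rfl⟩
  by_cases h1 : f x - x ∈ T'
  · by_cases h2 : g (f x) - f x ∈ T
    · exact absurd ⟨(_, _), ⟨h2, h1⟩, by simp⟩ hx
    · exact Or.inl ⟨f x, h2, rfl⟩
  · exact Or.inr ⟨f x, ⟨x, h1, rfl⟩, rfl⟩

theorem conj_translation (hf : IsSqueeze f) (v : EuclideanSpace ℝ (Fin d)) :
    IsSqueeze (fun x => f (x - v) + v) := by
  obtain ⟨fl, fs, T, hT, hfT⟩ := hf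
  refine ⟨?_, ?_, T, hT, ?_⟩
  · refine LipschitzWith.of_dist_le_mul fun x y => ?_
    simpa using fl.dist_le_mul (x - v) (y - v)
  · intro y
    obtain ⟨x, hx⟩ := fs (y - v)
    exact ⟨x + v, by simp [hx]⟩
  · refine (hfT.image_add_right v).mono ?_
    rintro _ ⟨x, hx, rfl⟩
    refine ⟨f (x - v), ⟨x - v, ?_, rfl⟩, rfl⟩
    simp only [Set.mem_ofPred_eq] at hx ⊢
    convert hx using 2
    abel

end IsSqueeze

/-! ### Squeezable sets and countable covers -/

/-- A set which can be mapped, together with a neighbourhood, into finitely many hyperplanes by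
arbitrarily small squeezes. -/
def IsSqueezable {d : ℕ} (K : Set (EuclideanSpace ℝ (Fin d))) : Prop :=
  ∀ ε : ℝ, 0 < ε → ∃ h, IsSqueeze h ∧ (∀ x, ‖h x - x‖ ≤ ε) ∧ ∃ U, IsOpen U ∧ K ⊆ U ∧
    IsFlat (h '' U)

namespace IsSqueezable

variable {d : ℕ} {K L : Set (EuclideanSpace ℝ (Fin d))}

theorem empty : IsSqueezable (∅ : Set (EuclideanSpace ℝ (Fin d))) := fun ε hε =>
  ⟨_, IsSqueeze.id, by simpa using hε.le, ∅, isOpen_empty, subset_rfl, by simpa using IsFlat.empty⟩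

theorem translate (hK : IsSqueezable K) (v : EuclideanSpace ℝ (Fin d)) :
    IsSqueezable ((fun x => x + v) '' K) := by
  intro ε hε
  obtain ⟨f, hf, hd, U, hU, hKU, hfl⟩ := hK ε hε
  refine ⟨_, hf.conj_translation v, fun x => ?_, (fun x => x - v) ⁻¹' U,
    hU.preimage (by fun_prop), ?_, ?_⟩
  · convert hd (x - v) using 2
    abel
  · rintro _ ⟨x, hx, rfl⟩
    simpa using hKU hx
  · refine (hfl.image_add_right v).mono ?_
    rintro _ ⟨x, hx, rfl⟩
    exact ⟨_, ⟨x - v, hx, rfl⟩, rfl⟩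

/-- The map `g` for `L` is chosen first but applied last: `f` flattens `K` and moves points so
little that `L` stays in the open set flattened by `g`. -/
theorem union (hK : IsSqueezable K) (hL : IsSqueezable L) (hLc : IsCompact L) :
    IsSqueezable (K ∪ L) := by
  intro ε hε
  obtain ⟨g, hg, hgd, V, hV, hLV, hgV⟩ := hL (ε / 2) (by positivity)
  obtain ⟨δ, hδ, hδV⟩ := hLc.exists_cthickening_subset_open hV hLV
  obtain ⟨f, hf, hfd, U, hU, hKU, hfU⟩ := hK (min (ε / 2) δ) (by positivity)
  refine ⟨_, hg.comp hf, fun x => ?_, U ∪ f ⁻¹' V,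
    hU.union (hV.preimage hf.1.continuous), ?_, ?_⟩
  · calc ‖g (f x) - x‖ = ‖(g (f x) - f x) + (f x - x)‖ := by congr 1; abel
      _ ≤ ε / 2 + ε / 2 := (norm_add_le _ _).trans
          (add_le_add (hgd _) ((hfd x).trans (min_le_left _ _)))
      _ = ε := by ring
  · refine Set.union_subset_union hKU fun x hx => hδV ?_
    refine Metric.mem_cthickening_of_dist_le _ x _ _ hx ?_
    rw [dist_eq_norm]
    exact (hfd x).trans (min_le_right _ _)
  · refine ((hg.isFlat_image hfU).union hgV).mono ?_
    rintro _ ⟨x, hx | hx, rfl⟩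
    · exact Or.inl ⟨_, ⟨x, hx, rfl⟩, rfl⟩
    · exact Or.inr ⟨f x, hx, rfl⟩

theorem biUnion_translate (hK : IsSqueezable K) (hKc : IsCompact K)
    {T : Set (EuclideanSpace ℝ (Fin d))} (hT : T.Finite) :
    IsSqueezable (⋃ t ∈ T, (fun x => x + t) '' K) := by
  induction T, hT using Set.Finite.induction_on with
  | empty => simpa using empty
  | @insert a s _ hs ih =>
    rw [Set.biUnion_insert, Set.union_comm]
    exact ih.union (hK.translate a) (hKc.image (by fun_prop))

/-- Any squeeze can be followed by a small squeeze in order to flatten a given squeezable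
compact set. -/
theorem exists_comp (hK : IsSqueezable K) (hKc : IsCompact K)
    {f : EuclideanSpace ℝ (Fin d) → EuclideanSpace ℝ (Fin d)} (hf : IsSqueeze f)
    {ε : ℝ} (hε : 0 < ε) :
    ∃ h, IsSqueeze h ∧ (∀ x, ‖h x - x‖ ≤ ε) ∧
      ∃ U, IsOpen U ∧ K ⊆ U ∧ IsFlat ((fun x => h (f x)) '' U) := by
  obtain ⟨-, -, T, hT, hfT⟩ := hf
  -- Up to a flat part, `f` carries `K` into finitely many translates of `K`, so `h` only has to
  -- flatten those.
  obtain ⟨h, hh, hd, V, hV, hKV, hhV⟩ := hK.biUnion_translate hKc hT ε hε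
  refine ⟨h, hh, hd, ⋂ t ∈ T, (fun x => x + t) ⁻¹' V,
    hT.isOpen_biInter fun t _ => hV.preimage (by fun_prop), ?_, ?_⟩
  · intro x hx
    simp only [Set.mem_iInter]
    exact fun t ht => hKV (Set.mem_biUnion ht ⟨x, hx, rfl⟩)
  · refine ((hh.isFlat_image hfT).union hhV).mono ?_
    rintro _ ⟨x, hx, rfl⟩
    by_cases h1 : f x - x ∈ T
    · right
      simp only [Set.mem_iInter] at hx
      exact ⟨f x, by simpa using hx _ h1, rfl⟩
    · exact Or.inl ⟨f x, ⟨x, h1, rfl⟩, rfl⟩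

/-- A compact set covered by countably many squeezable compact sets can be flattened by a squeeze
that is arbitrarily close to the identity. -/
theorem exists_isSqueeze_isFlat_image {Q : Set (EuclideanSpace ℝ (Fin d))} (hQ : IsCompact Q)
    {K : ℕ → Set (EuclideanSpace ℝ (Fin d))} (hK : ∀ n, IsSqueezable (K n))
    (hKc : ∀ n, IsCompact (K n)) (hcover : Q ⊆ ⋃ n, K n) {ε : ℝ} (hε : 0 < ε) :
    ∃ f, IsSqueeze f ∧ (∀ x, ‖f x - x‖ ≤ ε) ∧ IsFlat (f '' Q) := by
  have step : ∀ (n : ℕ) (f : {f : EuclideanSpace ℝ (Fin d) → EuclideanSpace ℝ (Fin d) //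
      IsSqueeze f}), ∃ h, IsSqueeze h ∧ (∀ x, ‖h x - x‖ ≤ ε / 2 * (1 / 2) ^ n) ∧
      ∃ U, IsOpen U ∧ K n ⊆ U ∧ IsFlat ((fun x => h (f.1 x)) '' U) :=
    fun n f => (hK n).exists_comp (hKc n) f.2 (by positivity)
  choose h hh hd U hU hKU hflat using step
  let F : ℕ → {f : EuclideanSpace ℝ (Fin d) → EuclideanSpace ℝ (Fin d) // IsSqueeze f} :=
    fun n => Nat.rec ⟨_, IsSqueeze.id⟩ (fun n f => ⟨_, (hh n f).comp f.2⟩) n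
  have Fsucc : ∀ n x, (F (n + 1)).1 x = h n (F n) ((F n).1 x) := fun n x => rfl
  have keep : ∀ n m, n < m → IsFlat ((F m).1 '' U n (F n)) := by
    intro n m hnm
    induction m, hnm using Nat.le_induction with
    | base => exact hflat n (F n)
    | succ m _ ih =>
      refine ((hh m (F m)).isFlat_image ih).mono ?_
      rintro _ ⟨x, hx, rfl⟩
      exact ⟨_, ⟨x, hx, rfl⟩, rfl⟩
  have close : ∀ n x, ‖(F n).1 x - x‖ ≤ ε * (1 - (1 / 2) ^ n) := by
    intro n x
    induction n with
    | zero => simp [F]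
    | succ n ih =>
      rw [Fsucc]
      calc _ = ‖(h n (F n) ((F n).1 x) - (F n).1 x) + ((F n).1 x - x)‖ := by congr 1; abel
        _ ≤ ε / 2 * (1 / 2) ^ n + ε * (1 - (1 / 2) ^ n) :=
          (norm_add_le _ _).trans (add_le_add (hd n _ _) ih)
        _ = _ := by ring
  -- Flattening neighbourhoods, not just the sets `K n`, is what lets compactness stop the recursion
  -- after finitely many steps.
  obtain ⟨s, hs⟩ := hQ.elim_finite_subcover (fun n => U n (F n)) (fun n => hU n _)
    (hcover.trans (Set.iUnion_mono fun n => hKU n _))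
  obtain ⟨N, hN⟩ := s.exists_nat_subset_range
  refine ⟨_, (F N).2, fun x => (close N x).trans ?_, ?_⟩
  · have : (0 : ℝ) ≤ (1 / 2) ^ N := by positivity
    nlinarith
  · refine (IsFlat.biUnion s.finite_toSet (F := fun n => (F N).1 '' U n (F n)) fun n hn =>
      keep n N (by simpa using hN hn)).mono ?_
    rintro _ ⟨x, hx, rfl⟩
    obtain ⟨n, hn, hxn⟩ := Set.mem_iUnion₂.1 (hs hx)
    exact Set.mem_biUnion hn ⟨x, hxn, rfl⟩

end IsSqueezable

/-! ### Proximal maps of piecewise affine convex functions -/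

section Prox

variable {d : ℕ} {ι : Type*} [Fintype ι] [Nonempty ι]

/-- The maximum of the affine functions `z ↦ ⟪a i, z⟫ + b i`. -/
noncomputable def maxAffine (a : ι → EuclideanSpace ℝ (Fin d)) (b : ι → ℝ)
    (z : EuclideanSpace ℝ (Fin d)) : ℝ :=
  Finset.univ.sup' Finset.univ_nonempty fun i => inner ℝ (a i) z + b i

variable (a : ι → EuclideanSpace ℝ (Fin d)) (b : ι → ℝ)

theorem le_maxAffine (i : ι) (z : EuclideanSpace ℝ (Fin d)) :
    inner ℝ (a i) z + b i ≤ maxAffine a b z :=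
  Finset.le_sup' (fun i => inner ℝ (a i) z + b i) (Finset.mem_univ i)

theorem exists_maxAffine_eq (z : EuclideanSpace ℝ (Fin d)) :
    ∃ i, maxAffine a b z = inner ℝ (a i) z + b i := by
  obtain ⟨i, -, hi⟩ := Finset.exists_mem_eq_sup' Finset.univ_nonempty
    fun i => inner ℝ (a i) z + b i
  exact ⟨i, hi⟩

theorem continuous_maxAffine : Continuous (maxAffine a b) := by
  unfold maxAffine
  exact Continuous.finset_sup'_apply _ fun i _ => by fun_prop

theorem maxAffine_segment_le (p z : EuclideanSpace ℝ (Fin d)) {t : ℝ} (ht : 0 ≤ t) (ht' : t ≤ 1) :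
    maxAffine a b (p + t • (z - p)) ≤ (1 - t) * maxAffine a b p + t * maxAffine a b z := by
  obtain ⟨i, hi⟩ := exists_maxAffine_eq a b (p + t • (z - p))
  rw [hi, inner_add_right, inner_smul_right, inner_sub_right]
  have h1 := mul_le_mul_of_nonneg_left (le_maxAffine a b i p) (sub_nonneg.2 ht')
  have h2 := mul_le_mul_of_nonneg_left (le_maxAffine a b i z) ht
  linarith

theorem maxAffine_le_add_norm {ε : ℝ} (ha : ∀ i, ‖a i‖ ≤ ε) (p z : EuclideanSpace ℝ (Fin d)) :
    maxAffine a b z ≤ maxAffine a b p + ε * ‖z - p‖ := by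
  obtain ⟨i, hi⟩ := exists_maxAffine_eq a b z
  have h1 := le_maxAffine a b i p
  have h2 : inner ℝ (a i) (z - p) ≤ ε * ‖z - p‖ :=
    (real_inner_le_norm _ _).trans (mul_le_mul_of_nonneg_right (ha i) (norm_nonneg _))
  rw [inner_sub_right] at h2
  linarith

/-- `v` is a subgradient of `maxAffine a b` at `p`. -/
def IsSubgradient (v p : EuclideanSpace ℝ (Fin d)) : Prop :=
  ∀ z, maxAffine a b p + inner ℝ v (z - p) ≤ maxAffine a b z

variable {a b}

theorem isSubgradient_of_active {i : ι} {p : EuclideanSpace ℝ (Fin d)}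
    (hi : maxAffine a b p = inner ℝ (a i) p + b i) : IsSubgradient a b (a i) p := by
  intro z
  have := le_maxAffine a b i z
  rw [hi, inner_sub_right]
  linarith

theorem IsSubgradient.norm_le {ε : ℝ} (ha : ∀ i, ‖a i‖ ≤ ε) {v p : EuclideanSpace ℝ (Fin d)}
    (h : IsSubgradient a b v p) : ‖v‖ ≤ ε := by
  have h1 := h (p + v)
  have h2 := maxAffine_le_add_norm a b ha p (p + v)
  rw [add_sub_cancel_left] at h1 h2
  rw [real_inner_self_eq_norm_sq] at h1
  obtain ⟨i⟩ := ‹Nonempty ι›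
  have := (norm_nonneg _).trans (ha i)
  by_contra! hlt
  nlinarith [norm_nonneg v]

/-- At a point where all active affine functions have the same gradient, this gradient is the only
subgradient. -/
theorem IsSubgradient.eq_of_active {v p : EuclideanSpace ℝ (Fin d)} (h : IsSubgradient a b v p)
    {i : ι} (hi : maxAffine a b p = inner ℝ (a i) p + b i)
    (huniq : ∀ j, maxAffine a b p = inner ℝ (a j) p + b j → a j = a i) : v = a i := by
  -- Near `p` in direction `w` piece `i` stays maximal, so the subgradient inequality gives `⟪v, w⟫
  -- ≤ ⟪a i, w⟫`, that is `‖w‖² ≤ 0`.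
  set w := v - a i with hw
  have hev : ∀ j, ∀ᶠ t : ℝ in nhdsWithin 0 (Set.Ioi 0),
      inner ℝ (a j) (p + t • w) + b j ≤ inner ℝ (a i) (p + t • w) + b i := by
    intro j
    by_cases hj : maxAffine a b p = inner ℝ (a j) p + b j
    · have hb : b j = b i := by
        have := huniq j hj
        rw [hi, this] at hj
        linarith
      rw [huniq j hj, hb]
      exact Filter.Eventually.of_forall fun _ => le_rfl
    · have hlt : inner ℝ (a j) p + b j < inner ℝ (a i) p + b i := by
        rw [← hi]
        exact lt_of_le_of_ne (le_maxAffine a b j p) (Ne.symm hj)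
      refine Filter.Eventually.filter_mono nhdsWithin_le_nhds ?_
      have hc1 : Continuous fun t : ℝ => inner ℝ (a j) (p + t • w) + b j := by fun_prop
      have hc2 : Continuous fun t : ℝ => inner ℝ (a i) (p + t • w) + b i := by fun_prop
      filter_upwards [(hc1.continuousAt (x := 0)).eventually_lt hc2.continuousAt
        (by simpa using hlt)] with t ht using ht.le
  obtain ⟨t, ht, ht0⟩ := ((Filter.eventually_all.2 hev).and self_mem_nhdsWithin).exists
  obtain ⟨j, hj⟩ := exists_maxAffine_eq a b (p + t • w)
  have h1 := h (p + t • w)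
  have h2 := ht j
  have h3 : t * inner ℝ w w ≤ 0 := by
    rw [hj, hi, add_sub_cancel_left, inner_smul_right] at h1
    rw [inner_add_right (a i), inner_smul_right (a i)] at h2
    have : inner ℝ w w = inner ℝ v w - inner ℝ (a i) w := by rw [← inner_sub_left]
    rw [this, mul_sub]
    linarith
  have h4 : inner ℝ w w ≤ 0 := nonpos_of_mul_nonpos_right h3 ht0
  exact sub_eq_zero.1 (real_inner_self_nonpos.1 h4)

variable (a b)

/-- The point `p` minimises `φ + ‖· - x‖² / 2`. Comparing with points of the segment from `p` to
`z`, dividing by `t` and letting `t → 0` gives the subgradient inequality. -/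
theorem exists_isSubgradient (x : EuclideanSpace ℝ (Fin d)) :
    ∃ p, IsSubgradient a b (x - p) p := by
  obtain ⟨i⟩ := ‹Nonempty ι›
  have hcont : Continuous fun p => maxAffine a b p + ‖p - x‖ ^ 2 / 2 := by
    have := continuous_maxAffine a b
    fun_prop
  have hcoer : Filter.Tendsto (fun p => maxAffine a b p + ‖p - x‖ ^ 2 / 2)
      (Filter.cocompact (EuclideanSpace ℝ (Fin d))) Filter.atTop := by
    have hlow : ∀ p, inner ℝ (a i) x + b i - ‖a i‖ ^ 2 - 1 + ‖p - x‖ / 4 ≤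
        maxAffine a b p + ‖p - x‖ ^ 2 / 2 := by
      intro p
      have h1 := le_maxAffine a b i p
      have h2 : inner ℝ (a i) (x - p) ≤ ‖a i‖ * ‖p - x‖ := by
        rw [norm_sub_rev]
        exact real_inner_le_norm _ _
      rw [inner_sub_right] at h2
      nlinarith [sq_nonneg (‖a i‖ - ‖p - x‖ / 2), sq_nonneg (‖p - x‖ - 1)]
    refine Filter.tendsto_atTop_mono hlow (Filter.tendsto_atTop_add_const_left _ _ ?_)
    refine Filter.Tendsto.atTop_div_const (by norm_num) ?_
    have := tendsto_dist_right_cocompact_atTop x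
    simpa [dist_eq_norm] using this
  obtain ⟨p, hp⟩ := hcont.exists_forall_le hcoer
  refine ⟨p, fun z => ?_⟩
  have key : ∀ t : ℝ, 0 < t → t ≤ 1 →
      maxAffine a b p + inner ℝ (x - p) (z - p) ≤ maxAffine a b z + t * (‖z - p‖ ^ 2 / 2) := by
    intro t ht ht1
    have h1 := hp (p + t • (z - p))
    have h2 := maxAffine_segment_le a b p z ht.le ht1
    have h3 : ‖p + t • (z - p) - x‖ ^ 2 =
        ‖p - x‖ ^ 2 - 2 * t * inner ℝ (x - p) (z - p) + t ^ 2 * ‖z - p‖ ^ 2 := by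
      have : p + t • (z - p) - x = t • (z - p) - (x - p) := by abel
      rw [this, norm_sub_sq_real, norm_smul, real_inner_smul_left, real_inner_comm,
        norm_sub_rev p x, mul_pow, Real.norm_eq_abs, sq_abs]
      ring
    rw [h3] at h1
    have h4 : t * (maxAffine a b p + inner ℝ (x - p) (z - p)) ≤
        t * (maxAffine a b z + t * (‖z - p‖ ^ 2 / 2)) := by nlinarith
    exact le_of_mul_le_mul_left h4 ht
  have hlim : Filter.Tendsto (fun t : ℝ => maxAffine a b z + t * (‖z - p‖ ^ 2 / 2))
      (nhdsWithin 0 (Set.Ioi 0)) (nhds (maxAffine a b z + 0 * (‖z - p‖ ^ 2 / 2))) := by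
    refine Filter.Tendsto.mono_left (Continuous.tendsto ?_ 0) nhdsWithin_le_nhds
    fun_prop
  rw [zero_mul, add_zero] at hlim
  refine ge_of_tendsto hlim ?_
  filter_upwards [Ioc_mem_nhdsGT (zero_lt_one' ℝ)] with t ht using key t ht.1 ht.2

/-- The proximal map of a maximum of finitely many affine functions with small gradients is a small
squeeze. It flattens the points which cannot be reached by the pieces on which it is invertible. -/
theorem exists_prox {ε : ℝ} (ha : ∀ i, ‖a i‖ ≤ ε) :
    ∃ h : EuclideanSpace ℝ (Fin d) → EuclideanSpace ℝ (Fin d), IsSqueeze h ∧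
      (∀ x, ‖h x - x‖ ≤ ε) ∧
      IsFlat (h '' {x | ∀ i, ∃ j, inner ℝ (a i) (x - a i) + b i <
        inner ℝ (a j) (x - a i) + b j}) := by
  choose h hh using exists_isSubgradient a b
  -- Monotonicity of the subdifferential: add the subgradient inequalities at `h x` and `h y`.
  have hmono : ∀ x y, ‖h x - h y‖ ^ 2 ≤ inner ℝ (x - y) (h x - h y) := by
    intro x y
    have h1 := hh x (h y)
    have h2 := hh y (h x)
    have h3 : inner ℝ (x - y) (h x - h y) - ‖h x - h y‖ ^ 2 =
        - inner ℝ (x - h x) (h y - h x) - inner ℝ (y - h y) (h x - h y) := by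
      rw [← real_inner_self_eq_norm_sq, ← inner_sub_left, ← neg_sub (h x) (h y), inner_neg_right,
        neg_neg, ← inner_sub_left]
      congr 1
      abel
    linarith
  have hlip : LipschitzWith 1 h := by
    refine LipschitzWith.of_dist_le_mul fun x y => ?_
    rw [NNReal.coe_one, one_mul, dist_eq_norm, dist_eq_norm]
    have h1 := (hmono x y).trans (real_inner_le_norm _ _)
    by_contra! hlt
    nlinarith [norm_nonneg (x - y)]
  have hinv : ∀ {p v}, IsSubgradient a b v p → h (p + v) = p := by
    intro p v hv
    have h1 := hh (p + v) p
    have h2 := hv (h (p + v))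
    have h3 : ‖h (p + v) - p‖ ^ 2 =
        inner ℝ (p + v - h (p + v)) (p - h (p + v)) + inner ℝ v (h (p + v) - p) := by
      rw [← neg_sub (h (p + v)) p, inner_neg_right, ← inner_neg_left, ← inner_add_left,
        ← real_inner_self_eq_norm_sq]
      congr 1
      abel
    have h4 : ‖h (p + v) - p‖ ^ 2 ≤ 0 := by linarith
    have h5 : ‖h (p + v) - p‖ = 0 := by nlinarith [norm_nonneg (h (p + v) - p)]
    exact sub_eq_zero.1 (norm_eq_zero.1 h5)
  have hsurj : Function.Surjective h := by
    intro p
    obtain ⟨i, hi⟩ := exists_maxAffine_eq a b p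
    exact ⟨p + a i, hinv (isSubgradient_of_active hi)⟩
  have hflat : IsFlat (⋃ q ∈ {q : ι × ι | a q.1 ≠ a q.2},
      {x | inner ℝ (a q.1 - a q.2) x = b q.2 - b q.1}) :=
    IsFlat.biUnion (Set.toFinite _) fun q hq =>
      IsFlat.of_isHyperplane ⟨_, _, sub_ne_zero.2 hq, rfl⟩
  have hdich : ∀ x, h x ∈ (⋃ q ∈ {q : ι × ι | a q.1 ≠ a q.2},
      {x | inner ℝ (a q.1 - a q.2) x = b q.2 - b q.1}) ∨
      ∃ i, x - h x = a i ∧ maxAffine a b (h x) = inner ℝ (a i) (h x) + b i := by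
    intro x
    obtain ⟨i, hi⟩ := exists_maxAffine_eq a b (h x)
    by_cases huniq : ∀ j, maxAffine a b (h x) = inner ℝ (a j) (h x) + b j → a j = a i
    · exact Or.inr ⟨i, (hh x).eq_of_active hi huniq, hi⟩
    · push Not at huniq
      obtain ⟨j, hj, hne⟩ := huniq
      refine Or.inl (Set.mem_biUnion (x := (j, i)) hne ?_)
      rw [Set.mem_ofPred_eq, inner_sub_left]
      linarith
  refine ⟨h, ⟨hlip, hsurj, Set.range fun i => - a i, Set.finite_range _, hflat.mono ?_⟩, ?_,
    hflat.mono ?_⟩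
  · rintro _ ⟨x, hx, rfl⟩
    refine (hdich x).resolve_right ?_
    rintro ⟨i, hi, -⟩
    exact hx ⟨i, (neg_eq_iff_eq_neg.2 (by rw [← hi]; abel))⟩
  · intro x
    rw [norm_sub_rev]
    exact (hh x).norm_le ha
  · rintro _ ⟨x, hx, rfl⟩
    refine (hdich x).resolve_right ?_
    -- Here `x - a i = h x`, where piece `i` is active, against the strict inequality assumed of
    -- `x`.
    rintro ⟨i, hi, hact⟩
    obtain ⟨j, hj⟩ := hx i
    rw [← hi, sub_sub_cancel] at hj
    have := le_maxAffine a b j (h x)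
    rw [hact] at this
    rw [← hi] at this
    linarith

/-- A criterion for being squeezable. -/
theorem isSqueezable_of_forall_exists_affine {K : Set (EuclideanSpace ℝ (Fin d))} {ε₀ : ℝ}
    (hε₀ : 0 < ε₀)
    (H : ∀ ε, 0 < ε → ε ≤ ε₀ → ∃ (κ : Type) (_ : Fintype κ) (_ : Nonempty κ)
      (a : κ → EuclideanSpace ℝ (Fin d)) (b : κ → ℝ), (∀ i, ‖a i‖ ≤ ε) ∧
      ∀ x ∈ K, ∀ i, ∃ j, inner ℝ (a i) (x - a i) + b i < inner ℝ (a j) (x - a i) + b j) :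
    IsSqueezable K := by
  intro ε hε
  obtain ⟨κ, _, _, a, b, ha, hK⟩ := H (min ε ε₀) (by positivity) (min_le_right _ _)
  obtain ⟨h, hsq, hd, hfl⟩ := exists_prox a b ha
  refine ⟨h, hsq, fun x => (hd x).trans (min_le_left _ _),
    {x | ∀ i, ∃ j, inner ℝ (a i) (x - a i) + b i < inner ℝ (a j) (x - a i) + b j}, ?_,
    fun x hx => hK x hx, hfl⟩
  have : {x | ∀ i, ∃ j, inner ℝ (a i) (x - a i) + b i < inner ℝ (a j) (x - a i) + b j} =
      ⋂ i, ⋃ j, {x | inner ℝ (a i) (x - a i) + b i < inner ℝ (a j) (x - a i) + b j} := by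
    ext x
    simp
  rw [this]
  exact isOpen_iInter_of_finite fun i => isOpen_iUnion fun j =>
    isOpen_lt (by fun_prop) (by fun_prop)

end Prox

/-! ### Convex hypersurfaces -/

theorem Convex.exists_unit_normal {d : ℕ} {C : Set (EuclideanSpace ℝ (Fin d))} (hC : Convex ℝ C)
    (hint : (interior C).Nonempty) {q : EuclideanSpace ℝ (Fin d)} (hq : q ∈ frontier C) :
    ∃ n : EuclideanSpace ℝ (Fin d), ‖n‖ = 1 ∧ ∀ x ∈ closure C, inner ℝ n (x - q) ≤ 0 := by
  obtain ⟨f, hf⟩ := geometric_hahn_banach_open_point hC.interior isOpen_interior hq.2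
  set v := (InnerProductSpace.toDual ℝ (EuclideanSpace ℝ (Fin d))).symm f with hv
  have hfv : ∀ x, f x = inner ℝ v x := fun x => by
    rw [hv, InnerProductSpace.toDual_symm_apply]
  have hv0 : v ≠ 0 := by
    intro h0
    obtain ⟨x, hx⟩ := hint
    have := hf x hx
    rw [hfv, hfv, h0] at this
    simp at this
  have hle : ∀ x ∈ closure C, inner ℝ v (x - q) ≤ 0 := by
    intro x hx
    rw [← hC.closure_interior_eq_closure_of_nonempty_interior hint] at hx
    refine closure_minimal (t := {x | inner ℝ v (x - q) ≤ 0}) (fun y hy => ?_)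
      (isClosed_le (by fun_prop) continuous_const) hx
    have := hf y hy
    rw [hfv, hfv] at this
    rw [Set.mem_ofPred_eq, inner_sub_right]
    linarith
  refine ⟨‖v‖⁻¹ • v, norm_smul_inv_norm hv0, fun x hx => ?_⟩
  rw [real_inner_smul_left]
  exact mul_nonpos_of_nonneg_of_nonpos (by positivity) (hle x hx)

theorem Convex.isSqueezable_of_subset_frontier {d : ℕ} {C K : Set (EuclideanSpace ℝ (Fin d))}
    (hC : Convex ℝ C) (hint : (interior C).Nonempty) (hK : IsCompact K) (hKC : K ⊆ frontier C) :
    IsSqueezable K := by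
  choose! n hn1 hn using fun q (hq : q ∈ frontier C) => hC.exists_unit_normal hint hq
  refine isSqueezable_of_forall_exists_affine one_pos fun ε hε _ => ?_
  obtain ⟨N, hNK, hNf, hN⟩ := hK.finite_cover_balls (half_pos hε)
  have := hNf.fintype
  -- The pieces are `0` and `ε (⟪n q, z - q⟫ + ε / 2)` for `q` in an `ε / 2`-net. At `x ∈ K` the
  -- piece of a nearby `q` beats `0`; at `x - ε n q` piece `q` is at most `-ε² / 2`, so `0` beats
  -- it.
  refine ⟨Option N, inferInstance, inferInstance, fun i => i.elim 0 fun q => ε • n q,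
    fun i => i.elim 0 fun q => ε * (ε / 2 - inner ℝ (n q) q), ?_, ?_⟩
  · rintro (_ | q)
    · simpa using hε.le
    · simp [norm_smul, hn1 _ (hKC (hNK q.2)), abs_of_pos hε]
  · rintro x hx (_ | q)
    · obtain ⟨q, hq, hxq⟩ := Set.mem_iUnion₂.1 (hN hx)
      refine ⟨some ⟨q, hq⟩, ?_⟩
      simp only [Option.elim, sub_zero, inner_zero_left, add_zero, real_inner_smul_left]
      rw [← mul_add]
      refine mul_pos hε ?_
      have h1 := abs_real_inner_le_norm (n q) (x - q)
      rw [hn1 _ (hKC (hNK hq)), one_mul, ← dist_eq_norm] at h1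
      have h2 := neg_abs_le (inner ℝ (n q) (x - q))
      rw [inner_sub_right] at h1 h2
      have h3 := Metric.mem_ball.1 hxq
      linarith
    · refine ⟨none, ?_⟩
      simp only [Option.elim, inner_zero_left, add_zero, real_inner_smul_left]
      rw [← mul_add]
      refine mul_neg_of_pos_of_neg hε ?_
      have h1 := hn q (hKC (hNK q.2)) x (frontier_subset_closure (hKC hx))
      have h2 : inner ℝ (n q) (ε • n q) = ε := by
        rw [real_inner_smul_right, real_inner_self_eq_norm_sq, hn1 _ (hKC (hNK q.2))]
        ring
      rw [inner_sub_right] at h1 ⊢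
      rw [h2]
      linarith

/-! ### Regular `C²` hypersurfaces -/

/-- A compact set which near each of its points lies, to second order, in a hyperplane whose normal
depends little on the point is squeezable. -/
theorem isSqueezable_of_quadratic_normals {d : ℕ} {K : Set (EuclideanSpace ℝ (Fin d))}
    (hK : IsCompact K) {κ : ℝ} (hκ : 0 ≤ κ) (c n₀ : EuclideanSpace ℝ (Fin d)) (hn₀ : ‖n₀‖ = 1)
    (hc : ∀ q ∈ K, κ * ‖q - c‖ ≤ 1 / 16)
    (hn : ∀ q ∈ K, ∃ n : EuclideanSpace ℝ (Fin d), ‖n‖ ≤ 1 ∧ ‖n - n₀‖ ≤ 1 / 16 ∧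
      ∀ x ∈ K, |inner ℝ n (x - q)| ≤ κ * ‖x - q‖ ^ 2) :
    IsSqueezable K := by
  rcases K.eq_empty_or_nonempty with rfl | hne
  · exact IsSqueezable.empty
  choose! n hn1 hn2 hn3 using hn
  have hnn : ∀ q ∈ K, ∀ p ∈ K, 3 / 4 ≤ inner ℝ (n p) (n q) := by
    intro q hq p hp
    have h1 := (abs_le.1 (abs_real_inner_le_norm (n p) (n q - n₀))).1
    have h2 := (abs_le.1 (abs_real_inner_le_norm (n p - n₀) n₀)).1
    rw [inner_sub_right] at h1
    rw [inner_sub_left, real_inner_self_eq_norm_sq, hn₀] at h2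
    have h3 := mul_le_mul (hn1 p hp) (hn2 q hq) (norm_nonneg _) zero_le_one
    have h4 := hn2 p hp
    linarith
  refine isSqueezable_of_forall_exists_affine (ε₀ := 1 / (16 * κ + 1)) (by positivity)
    fun ε hε hε₀ => ?_
  set t := ε / 2 with ht
  have ht0 : 0 < t := half_pos hε
  have htκ : κ * t ≤ 1 / 32 := by
    rw [le_div_iff₀ (by positivity)] at hε₀
    nlinarith
  obtain ⟨N, hNK, hNf, hN⟩ := hK.finite_cover_balls (e := t / 8) (by positivity)
  have := hNf.fintype
  have hNne : N.Nonempty := by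
    obtain ⟨x, hx⟩ := hne
    obtain ⟨q, hq, -⟩ := Set.mem_iUnion₂.1 (hN hx)
    exact ⟨q, hq⟩
  have := hNne.to_subtype
  -- Each net point carries two pieces, one per side. The term `4κ(q - c)` comes from adding `2κ‖z -
  -- c‖²` to `±⟪n q, z - q⟫ - 2κ‖z - q‖²`: the quadratic parts cancel and the piece is affine, while
  -- the common summand does not affect comparisons.
  let w : N × ℤˣ → EuclideanSpace ℝ (Fin d) := fun i =>
    ((i.2 : ℤ) : ℝ) • n i.1 + (4 * κ) • ((i.1 : EuclideanSpace ℝ (Fin d)) - c)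
  have hshift : ∀ q ∈ K, ‖(4 * κ) • (q - c)‖ ≤ 1 / 4 := by
    intro q hq
    rw [norm_smul, Real.norm_of_nonneg (by positivity)]
    linarith [hc q hq]
  have hsgn : ∀ s : ℤˣ, (((s : ℤ) : ℝ) = 1 ∧ (((-s : ℤˣ) : ℤ) : ℝ) = -1) ∨
      (((s : ℤ) : ℝ) = -1 ∧ (((-s : ℤˣ) : ℤ) : ℝ) = 1) := by
    intro s
    rcases Int.units_eq_one_or s with rfl | rfl <;> simp
  have hw : ∀ i, ‖w i‖ ≤ 5 / 4 := by
    rintro ⟨q, s⟩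
    refine (norm_add_le _ _).trans ?_
    have h1 := hn1 q (hNK q.2)
    have h2 := hshift q (hNK q.2)
    have h3 : ‖((s : ℤ) : ℝ) • n q‖ ≤ 1 := by
      rcases hsgn s with ⟨h, -⟩ | ⟨h, -⟩ <;> simpa [h] using h1
    linarith
  -- the pairing of a normal with the shift of a cell
  have hpair : ∀ i : N × ℤˣ, ∀ p ∈ K, 1 / 2 ≤ ((i.2 : ℤ) : ℝ) * inner ℝ (n p) (w i) := by
    rintro ⟨q, s⟩ p hp
    have h1 := hnn q (hNK q.2) p hp
    have h2 := abs_real_inner_le_norm (n p) ((4 * κ) • ((q : EuclideanSpace ℝ (Fin d)) - c))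
    have h3 := mul_le_mul (hn1 p hp) (hshift q (hNK q.2)) (norm_nonneg _) zero_le_one
    have h4 := abs_le.1 (h2.trans h3)
    simp only [w, inner_add_right]
    rw [real_inner_smul_right (n p) (n q)]
    rcases hsgn s with ⟨h, -⟩ | ⟨h, -⟩ <;> rw [h] <;> linarith [h4.1, h4.2]
  have hnorm : ∀ (x q : EuclideanSpace ℝ (Fin d)) (i : N × ℤˣ),
      ‖x - t • w i - q‖ ^ 2 ≤ 2 * ‖x - q‖ ^ 2 + 4 * t ^ 2 ∧
      ‖x - q‖ ^ 2 ≤ 2 * ‖x - t • w i - q‖ ^ 2 + 4 * t ^ 2 := by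
    intro x q i
    have h1 : ‖t • w i‖ ≤ t * (5 / 4) := by
      rw [norm_smul, Real.norm_of_nonneg ht0.le]
      exact mul_le_mul_of_nonneg_left (hw i) ht0.le
    have h2 : ‖t • w i‖ ^ 2 ≤ 2 * t ^ 2 := by nlinarith [norm_nonneg (t • w i)]
    have h3 : ‖x - t • w i - q‖ ≤ ‖x - q‖ + ‖t • w i‖ := by
      have : x - t • w i - q = (x - q) - t • w i := by abel
      rw [this]
      exact norm_sub_le _ _
    have h4 : ‖x - q‖ ≤ ‖x - t • w i - q‖ + ‖t • w i‖ := by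
      have : x - q = (x - t • w i - q) + t • w i := by abel
      rw [this]
      exact norm_add_le _ _
    constructor
    · nlinarith [norm_nonneg (x - t • w i - q), sq_nonneg (‖x - q‖ - ‖t • w i‖)]
    · nlinarith [norm_nonneg (x - q), sq_nonneg (‖x - t • w i - q‖ - ‖t • w i‖)]
  refine ⟨N × ℤˣ, inferInstance, inferInstance, fun i => t • w i,
    fun i => t * (2 * κ * ‖(i.1 : EuclideanSpace ℝ (Fin d)) - c‖ ^ 2 -
      inner ℝ (w i) (i.1 : EuclideanSpace ℝ (Fin d))), ?_, ?_⟩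
  · intro i
    rw [norm_smul, Real.norm_of_nonneg ht0.le]
    nlinarith [hw i]
  have hval : ∀ (i : N × ℤˣ) (z : EuclideanSpace ℝ (Fin d)),
      inner ℝ (t • w i) z + t * (2 * κ * ‖(i.1 : EuclideanSpace ℝ (Fin d)) - c‖ ^ 2 -
        inner ℝ (w i) (i.1 : EuclideanSpace ℝ (Fin d))) =
      t * (2 * κ * ‖z - c‖ ^ 2 + (((i.2 : ℤ) : ℝ) *
        inner ℝ (n i.1) (z - (i.1 : EuclideanSpace ℝ (Fin d))) -
        2 * κ * ‖z - (i.1 : EuclideanSpace ℝ (Fin d))‖ ^ 2)) := by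
    rintro ⟨q, s⟩ z
    have h1 : ‖z - c‖ ^ 2 = ‖z - (q : EuclideanSpace ℝ (Fin d))‖ ^ 2 +
        2 * inner ℝ ((q : EuclideanSpace ℝ (Fin d)) - c) (z - q) +
        ‖(q : EuclideanSpace ℝ (Fin d)) - c‖ ^ 2 := by
      have : z - c = (z - q) + ((q : EuclideanSpace ℝ (Fin d)) - c) := by abel
      rw [this, norm_add_sq_real, real_inner_comm]
    have h2 : inner ℝ (w (q, s)) (z - q) = ((s : ℤ) : ℝ) * inner ℝ (n q) (z - q) +
        4 * κ * inner ℝ ((q : EuclideanSpace ℝ (Fin d)) - c) (z - q) := by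
      simp only [w]
      rw [inner_add_left, real_inner_smul_left, real_inner_smul_left]
    rw [h1, real_inner_smul_left]
    rw [inner_sub_right] at h2
    simp only at h2 ⊢
    linear_combination t * h2
  rintro x hx ⟨q, s⟩
  obtain ⟨p, hp, hxp⟩ := Set.mem_iUnion₂.1 (hN hx)
  -- The shift by `-t • w (q, s)` goes to the side where `(q, s)` is low and the opposite sign at a
  -- net point `p` near `x` is high. The penalty `-2κ‖z - q‖²` absorbs the curvature error `κ‖x -
  -- q‖²` for `q` far from `x`.
  refine ⟨(⟨p, hp⟩, -s), ?_⟩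
  rw [hval, hval]
  refine mul_lt_mul_of_pos_left ?_ ht0
  simp only
  set z := x - t • w (q, s) with hz
  have hxp' : ‖x - p‖ ≤ t / 8 := by
    rw [← dist_eq_norm]
    exact (Metric.mem_ball.1 hxp).le
  have hqK := hNK q.2
  have hpK := hNK hp
  have e1 : inner ℝ (n q) (z - q) = inner ℝ (n q) (x - q) - t * inner ℝ (n q) (w (q, s)) := by
    rw [← real_inner_smul_right, ← inner_sub_right]
    congr 1
    rw [hz]
    abel
  have e2 : inner ℝ (n p) (z - p) = inner ℝ (n p) (x - p) - t * inner ℝ (n p) (w (q, s)) := by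
    rw [← real_inner_smul_right, ← inner_sub_right]
    congr 1
    rw [hz]
    abel
  have p1 := mul_le_mul_of_nonneg_left (hpair (q, s) q hqK) ht0.le
  have p2 := mul_le_mul_of_nonneg_left (hpair (q, s) p hpK) ht0.le
  have b1 := abs_le.1 (hn3 q hqK x hx)
  have b2 := abs_le.1 ((abs_real_inner_le_norm (n p) (x - p)).trans
    (mul_le_mul (hn1 p hpK) hxp' (norm_nonneg _) zero_le_one))
  have q1 := mul_le_mul_of_nonneg_left (hnorm x q (q, s)).2 hκ
  have q2 := mul_le_mul_of_nonneg_left (hnorm x p (q, s)).1 hκ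
  have q3 : κ * ‖x - p‖ ^ 2 ≤ κ * (t / 8) ^ 2 :=
    mul_le_mul_of_nonneg_left (by gcongr) hκ
  have q4 : κ * t * t ≤ 1 / 32 * t := mul_le_mul_of_nonneg_right htκ ht0.le
  rw [← hz] at q1 q2
  rw [e1, e2]
  simp only at p1 p2
  rcases hsgn s with ⟨h, h'⟩ | ⟨h, h'⟩ <;> rw [h] at p1 p2 <;> rw [h, h'] <;>
    nlinarith [b1.1, b1.2, b2.1, b2.2]

/-- The image of a small ball under a `C²` immersion of positive codimension is squeezable. -/
theorem exists_isSqueezable_image_closedBall {d k : ℕ} (hkd : k < d)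
    {F : EuclideanSpace ℝ (Fin k) → EuclideanSpace ℝ (Fin d)} {u₀ : EuclideanSpace ℝ (Fin k)}
    {U : Set (EuclideanSpace ℝ (Fin k))} (hU : IsOpen U) (hF : ContDiffOn ℝ 2 F U) (hu₀ : u₀ ∈ U)
    (hrank : Module.finrank ℝ (LinearMap.range (fderiv ℝ F u₀).toLinearMap) = k) :
    ∃ r > 0, Metric.closedBall u₀ r ⊆ U ∧ IsSqueezable (F '' Metric.closedBall u₀ r) := by
  set D := fderiv ℝ F with hD
  have hFat : ContDiffAt ℝ 2 F u₀ := hF.contDiffAt (hU.mem_nhds hu₀)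
  obtain ⟨L, s, hs, hLs⟩ := (hFat.fderiv_right (m := 1) (by norm_num)).exists_lipschitzOnWith
  have hker : LinearMap.ker (D u₀).toLinearMap = ⊥ := by
    have := LinearMap.finrank_range_add_finrank_ker (D u₀).toLinearMap
    rw [hrank, finrank_euclideanSpace_fin] at this
    exact Submodule.finrank_eq_zero.1 (by omega)
  obtain ⟨K, hK, hanti⟩ := (D u₀).toLinearMap.exists_antilipschitzWith hker
  set m : ℝ := (K : ℝ)⁻¹ with hm
  have hm0 : 0 < m := inv_pos.2 (by exact_mod_cast hK)
  have hlow₀ : ∀ w, m * ‖w‖ ≤ ‖D u₀ w‖ := by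
    intro w
    have h1 := hanti.le_mul_dist w 0
    rw [map_zero, dist_zero_right, dist_zero_right] at h1
    rw [hm, inv_mul_le_iff₀ (by exact_mod_cast hK)]
    exact h1
  obtain ⟨n₀, hn₀, hn₀D⟩ : ∃ n₀ : EuclideanSpace ℝ (Fin d), ‖n₀‖ = 1 ∧
      ∀ w, inner ℝ (D u₀ w) n₀ = 0 := by
    have hne : (LinearMap.range (D u₀).toLinearMap)ᗮ ≠ ⊥ := by
      intro h
      rw [Submodule.orthogonal_eq_bot_iff] at h
      rw [h, finrank_top, finrank_euclideanSpace_fin] at hrank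
      omega
    obtain ⟨v, hv, hv0⟩ := Submodule.exists_mem_ne_zero_of_ne_bot hne
    refine ⟨‖v‖⁻¹ • v, norm_smul_inv_norm hv0, fun w => ?_⟩
    have hwv : inner ℝ (D u₀ w) v = 0 := (Submodule.mem_orthogonal _ _).1 hv _ ⟨w, rfl⟩
    rw [real_inner_smul_right, hwv, mul_zero]
  -- The Taylor error is at most `L‖v - u‖²`, and `‖v - u‖ ≤ (2 / m)‖F v - F u‖` on the small ball.
  set κ : ℝ := L * (4 / m ^ 2) with hκ
  have hκ0 : 0 ≤ κ := by positivity
  have hev : ∀ᶠ u in nhds u₀, κ * ‖F u - F u₀‖ < 1 / 16 := by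
    have hc : ContinuousAt (fun u => κ * ‖F u - F u₀‖) u₀ :=
      continuousAt_const.mul (hFat.continuousAt.sub continuousAt_const).norm
    exact hc.eventually_lt continuousAt_const (by simp)
  obtain ⟨r₁, hr₁, hball⟩ := Metric.nhds_basis_closedBall.mem_iff.1
    (Filter.inter_mem (Filter.inter_mem hs (hU.mem_nhds hu₀)) hev)
  set r : ℝ := min r₁ (m / (32 * (L + 1))) with hr
  have hr0 : 0 < r := lt_min hr₁ (by positivity)
  have hLr : L * r ≤ m / 32 := by
    have h1 : r ≤ m / (32 * (L + 1)) := min_le_right _ _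
    rw [le_div_iff₀ (by positivity)] at h1
    nlinarith [L.coe_nonneg]
  have hsub : Metric.closedBall u₀ r ⊆ Metric.closedBall u₀ r₁ :=
    Metric.closedBall_subset_closedBall (min_le_left _ _)
  have hBs : Metric.closedBall u₀ r ⊆ s := fun u hu => (hball (hsub hu)).1.1
  have hBU : Metric.closedBall u₀ r ⊆ U := fun u hu => (hball (hsub hu)).1.2
  have hu₀B : u₀ ∈ Metric.closedBall u₀ r := Metric.mem_closedBall_self hr0.le
  have hDlip : ∀ u ∈ Metric.closedBall u₀ r, ∀ v ∈ Metric.closedBall u₀ r,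
      ‖D v - D u‖ ≤ L * ‖v - u‖ := by
    intro u hu v hv
    rw [← dist_eq_norm, ← dist_eq_norm]
    exact hLs.dist_le_mul v (hBs hv) u (hBs hu)
  have hDclose : ∀ u ∈ Metric.closedBall u₀ r, ‖D u - D u₀‖ ≤ m / 32 := by
    intro u hu
    refine (hDlip u₀ hu₀B u hu).trans (le_trans ?_ hLr)
    rw [← dist_eq_norm]
    exact mul_le_mul_of_nonneg_left hu L.coe_nonneg
  have hlow : ∀ u ∈ Metric.closedBall u₀ r, ∀ w, (m - m / 32) * ‖w‖ ≤ ‖D u w‖ := by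
    intro u hu w
    have h1 := (D u - D u₀).le_of_opNorm_le (hDclose u hu) w
    have h2 := norm_sub_norm_le (D u₀ w) (D u w)
    rw [norm_sub_rev, ← sub_apply] at h2
    linarith [hlow₀ w]
  have htaylor : ∀ u ∈ Metric.closedBall u₀ r, ∀ v ∈ Metric.closedBall u₀ r,
      ‖F v - F u - D u (v - u)‖ ≤ L * ‖v - u‖ * ‖v - u‖ := by
    intro u hu v hv
    have hseg : segment ℝ u v ⊆ Metric.closedBall u₀ r :=
      (convex_closedBall u₀ r).segment_subset hu hv
    refine Convex.norm_image_sub_le_of_norm_hasFDerivWithin_le' (f' := D) (s := segment ℝ u v)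
      (fun x hx => ?_) (fun x hx => ?_) (convex_segment u v) (left_mem_segment ℝ u v)
      (right_mem_segment ℝ u v)
    · have hxU := hBU (hseg hx)
      exact ((hF.contDiffAt (hU.mem_nhds hxU)).differentiableAt
        (by norm_num)).hasFDerivAt.hasFDerivWithinAt
    · refine (hDlip u hu x (hseg hx)).trans (mul_le_mul_of_nonneg_left ?_ L.coe_nonneg)
      exact norm_sub_le_of_mem_segment hx
  have hexp : ∀ u ∈ Metric.closedBall u₀ r, ∀ v ∈ Metric.closedBall u₀ r,
      m / 2 * ‖v - u‖ ≤ ‖F v - F u‖ := by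
    intro u hu v hv
    have h1 := htaylor u hu v hv
    have h2 := hlow u hu (v - u)
    have h3 : ‖D u (v - u)‖ - ‖F v - F u‖ ≤ ‖F v - F u - D u (v - u)‖ := by
      rw [norm_sub_rev (F v - F u)]
      exact norm_sub_norm_le _ _
    have h4 : ‖v - u‖ ≤ 2 * r := by
      rw [← dist_eq_norm]
      linarith [dist_triangle_right v u u₀, Metric.mem_closedBall.1 hv, Metric.mem_closedBall.1 hu]
    have h5 : L * ‖v - u‖ ≤ m / 16 := by nlinarith [L.coe_nonneg]
    have h6 := mul_le_mul_of_nonneg_right h5 (norm_nonneg (v - u))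
    nlinarith [norm_nonneg (v - u)]
  refine ⟨r, hr0, hBU, isSqueezable_of_quadratic_normals
    ((isCompact_closedBall u₀ r).image_of_continuousOn (hF.continuousOn.mono hBU)) hκ0 (F u₀) n₀
    hn₀ ?_ ?_⟩
  · rintro _ ⟨u, hu, rfl⟩
    exact (hball (hsub hu)).2.le
  rintro _ ⟨u, hu, rfl⟩
  -- The normal at `F u` is the projection `n` of `n₀` onto the orthogonal complement of the tangent
  -- space. The removed part `y` is small because `n₀` is orthogonal to the range of the nearby `D
  -- u₀`.
  obtain ⟨y, ⟨w, hw⟩, n, hn, hyn⟩ :=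
    (LinearMap.range (D u).toLinearMap).exists_add_mem_mem_orthogonal n₀
  have hnD : ∀ w, inner ℝ n (D u w) = 0 := fun w => by
    rw [real_inner_comm]
    exact (Submodule.mem_orthogonal _ _).1 hn _ ⟨w, rfl⟩
  have hw' : D u w = y := hw
  have hny : inner ℝ n y = 0 := by rw [← hw', hnD]
  have hn1 : ‖n‖ ≤ 1 := by
    have h1 : ‖n₀‖ ^ 2 = ‖y‖ ^ 2 + ‖n‖ ^ 2 := by
      rw [hyn, norm_add_sq_real, real_inner_comm, hny]
      ring
    rw [hn₀] at h1
    nlinarith [norm_nonneg n, sq_nonneg ‖y‖]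
  refine ⟨n, hn1, ?_, ?_⟩
  · have h1 : ‖y‖ ^ 2 = inner ℝ ((D u - D u₀) w) n₀ := by
      rw [sub_apply, inner_sub_left, hn₀D, hw', sub_zero, hyn,
        inner_add_right, real_inner_comm n y, hny, real_inner_self_eq_norm_sq, add_zero]
    have h2 : inner ℝ ((D u - D u₀) w) n₀ ≤ m / 32 * ‖w‖ := by
      refine (real_inner_le_norm _ _).trans ?_
      rw [hn₀, mul_one]
      exact (D u - D u₀).le_of_opNorm_le (hDclose u hu) w
    have h3 := hlow u hu w
    rw [hw'] at h3
    have h4 : ‖y‖ ^ 2 ≤ 1 / 16 * ‖y‖ := by nlinarith [mul_nonneg hm0.le (norm_nonneg w)]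
    have h5 : n - n₀ = -y := by rw [hyn]; abel
    rw [h5, norm_neg]
    by_contra! hlt
    nlinarith
  · rintro _ ⟨v, hv, rfl⟩
    have h1 : inner ℝ n (F v - F u) = inner ℝ n (F v - F u - D u (v - u)) := by
      rw [inner_sub_right n (F v - F u), hnD, sub_zero]
    have h2 : ‖v - u‖ ^ 2 ≤ 4 / m ^ 2 * ‖F v - F u‖ ^ 2 := by
      have h3 := pow_le_pow_left₀ (by positivity) (hexp u hu v hv) 2
      rw [div_mul_eq_mul_div, le_div_iff₀ (by positivity)]
      nlinarith
    calc |inner ℝ n (F v - F u)| ≤ ‖n‖ * ‖F v - F u - D u (v - u)‖ := by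
          rw [h1]
          exact abs_real_inner_le_norm _ _
      _ ≤ 1 * (L * ‖v - u‖ * ‖v - u‖) :=
          mul_le_mul hn1 (htaylor u hu v hv) (norm_nonneg _) zero_le_one
      _ = L * ‖v - u‖ ^ 2 := by ring
      _ ≤ L * (4 / m ^ 2 * ‖F v - F u‖ ^ 2) := mul_le_mul_of_nonneg_left h2 L.coe_nonneg
      _ = κ * ‖F v - F u‖ ^ 2 := by rw [hκ]; ring

/-- A `C¹` image of a convex set in dimension `k` has Hausdorff dimension at most `k < d`. -/
theorem volume_image_eq_zero_of_contDiffOn {d k : ℕ} (hkd : k < d)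
    {F : EuclideanSpace ℝ (Fin k) → EuclideanSpace ℝ (Fin d)}
    {B : Set (EuclideanSpace ℝ (Fin k))} (hB : Convex ℝ B) (hF : ContDiffOn ℝ 1 F B) :
    volume (F '' B) = 0 := by
  have h1 : dimH (F '' B) < ((d : NNReal) : ENNReal) := by
    calc dimH (F '' B) ≤ dimH B := hF.dimH_image_le hB subset_rfl
      _ ≤ dimH (Set.univ : Set (EuclideanSpace ℝ (Fin k))) := dimH_mono (Set.subset_univ _)
      _ = (k : ENNReal) := by rw [Real.dimH_univ_eq_finrank, finrank_euclideanSpace_fin]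
      _ < _ := by exact_mod_cast hkd
  have hhaar : (Measure.hausdorffMeasure (d : ℝ) :
      Measure (EuclideanSpace ℝ (Fin d))).IsAddHaarMeasure := by
    simpa using MeasureTheory.isAddHaarMeasure_hausdorffMeasure (E := EuclideanSpace ℝ (Fin d))
  have h2 : (volume : Measure (EuclideanSpace ℝ (Fin d))) ≪ Measure.hausdorffMeasure (d : ℝ) :=
    Measure.absolutelyContinuous_isAddHaarMeasure _ _
  exact measure_zero_of_dimH_lt (d := (d : NNReal)) (by simpa using h2) h1

/-! ### Covering the boundary and conclusion -/

/-- A hypersurface of either kind is covered by countably many squeezable compact null sets. -/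
theorem exists_countable_squeezable_cover {d : ℕ} (hd : 1 ≤ d)
    {M : Set (EuclideanSpace ℝ (Fin d))}
    (hM : IsConvexHypersurface M ∨ IsRegularC2Hypersurface M) :
    ∃ 𝒦 : Set (Set (EuclideanSpace ℝ (Fin d))), 𝒦.Countable ∧
      (∀ K ∈ 𝒦, IsCompact K ∧ IsSqueezable K ∧ volume K = 0) ∧ M ⊆ ⋃₀ 𝒦 := by
  rcases hM with ⟨C, O, hC, hint, -, rfl⟩ | ⟨U, F, hU, hF, hrank, rfl⟩
  · refine ⟨Set.range fun n : ℕ => frontier C ∩ Metric.closedBall 0 n, Set.countable_range _,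
      ?_, ?_⟩
    · rintro _ ⟨n, rfl⟩
      have hc : IsCompact (frontier C ∩ Metric.closedBall 0 (n : ℝ)) :=
        (isCompact_closedBall _ _).inter_left isClosed_frontier
      exact ⟨hc, hC.isSqueezable_of_subset_frontier hint hc Set.inter_subset_left,
        measure_mono_null Set.inter_subset_left (hC.addHaar_frontier volume)⟩
    · rintro x ⟨-, hx⟩
      obtain ⟨n, hn⟩ := exists_nat_ge ‖x‖
      exact ⟨_, ⟨n, rfl⟩, hx, by simpa using hn⟩
  · choose! r hr0 hrU hrs using fun u (hu : u ∈ U) =>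
      exists_isSqueezable_image_closedBall (by omega : d - 1 < d) hU hF hu (hrank u hu)
    obtain ⟨t, htU, htc, hcov⟩ := TopologicalSpace.countable_cover_nhdsWithin
      (f := fun u => Metric.closedBall u (r u)) (s := U)
      fun u hu => mem_nhdsWithin_of_mem_nhds (Metric.closedBall_mem_nhds u (hr0 u hu))
    refine ⟨(fun u => F '' Metric.closedBall u (r u)) '' t, htc.image _, ?_, ?_⟩
    · rintro _ ⟨u, hu, rfl⟩
      have hFB := hF.mono (hrU u (htU hu))
      exact ⟨(isCompact_closedBall _ _).image_of_continuousOn hFB.continuousOn, hrs u (htU hu),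
        volume_image_eq_zero_of_contDiffOn (by omega) (convex_closedBall _ _)
          (hFB.of_le (by norm_num))⟩
    · rintro _ ⟨u, hu, rfl⟩
      obtain ⟨v, hv, huv⟩ := Set.mem_iUnion₂.1 (hcov hu)
      exact ⟨_, ⟨v, hv, rfl⟩, u, huv, rfl⟩

/-- A squeeze which flattens the boundary of a bounded set maps this set onto a polyhedron. -/
theorem IsSqueeze.isPolyhedron_image {d : ℕ}
    {f : EuclideanSpace ℝ (Fin d) → EuclideanSpace ℝ (Fin d)} (hf : IsSqueeze f)
    {A : Set (EuclideanSpace ℝ (Fin d))} (hA : Bornology.IsBounded A)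
    (hfl : IsFlat (f '' frontier A)) : IsPolyhedron (f '' A) := by
  obtain ⟨hlip, -, T, hT, hfT⟩ := hf
  obtain ⟨Z, hZ, hZc, hZfl⟩ := (hfl.union hfT).exists_isClosed_superset
  refine hZfl.mono fun y hy => ?_
  by_contra hyZ
  obtain ⟨x, hx, rfl⟩ : y ∈ f '' closure A := by
    refine closure_minimal (Set.image_mono subset_closure) ?_ hy.1
    exact (hA.isCompact_closure.image hlip.continuous).isClosed
  have hxint : x ∈ interior A := by
    by_contra hxi
    exact hyZ (hZ (Or.inl ⟨x, ⟨hx, hxi⟩, rfl⟩))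
  have hmem : ∀ z, f z ∉ Z → f z - z ∈ T := fun z hz => by
    by_contra h
    exact hz (hZ (Or.inr ⟨z, h, rfl⟩))
  have hev1 : ∀ᶠ z in nhds x, f z ∉ Z :=
    hlip.continuous.continuousAt.eventually (hZc.isOpen_compl.mem_nhds hyZ)
  -- A continuous displacement with values in a finite set is locally constant, so `f` is a
  -- translation near `x`.
  have hev2 : ∀ᶠ z in nhds x, f z - z ∉ T \ {f x - x} := by
    have hc : ContinuousAt (fun z => f z - z) x :=
      (hlip.continuous.sub continuous_id).continuousAt
    exact hc.eventually
      (((hT.subset Set.sdiff_subset).isClosed.isOpen_compl).mem_nhds (by simp))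
  have hev3 : ∀ᶠ z in nhds x, z ∈ A ∧ f z = z + (f x - x) := by
    filter_upwards [hev1, hev2, mem_interior_iff_mem_nhds.1 hxint] with z h1 h2 h3
    refine ⟨h3, ?_⟩
    have h4 : f z - z = f x - x := by
      by_contra h
      exact h2 ⟨hmem z h1, h⟩
    rw [← h4]
    abel
  refine hy.2 (mem_interior_iff_mem_nhds.2 ?_)
  have ht : Filter.Tendsto (fun w => w - (f x - x)) (nhds (f x)) (nhds x) := by
    have : Continuous fun w => w - (f x - x) := by fun_prop
    simpa using this.tendsto (f x)
  filter_upwards [ht.eventually hev3] with w hw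
  exact ⟨_, hw.1, by rw [hw.2]; simp⟩

theorem mainTheorem8 {d : ℕ} (hd : 1 ≤ d) (A : Set (EuclideanSpace ℝ (Fin d)))
    (hA : Bornology.IsBounded A)
    (𝓢 : Set (Set (EuclideanSpace ℝ (Fin d)))) (h𝓢 : 𝓢.Countable)
    (hyp : ∀ M ∈ 𝓢, IsConvexHypersurface M ∨ IsRegularC2Hypersurface M)
    (hcover : frontier A ⊆ ⋃₀ 𝓢) :
    IsDistanceKolmogorov A ∧ IsMeasureKolmogorov A := by
  choose! 𝒦 h𝒦c h𝒦 hM𝒦 using fun M (hM : M ∈ 𝓢) => exists_countable_squeezable_cover hd (hyp M hM)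
  -- Adding `∅` makes the family nonempty, so that a sequence can enumerate it.
  obtain ⟨K, hK⟩ := ((h𝓢.biUnion h𝒦c).insert ∅).exists_eq_range (Set.insert_nonempty _ _)
  have hKprop : ∀ n, IsCompact (K n) ∧ IsSqueezable (K n) ∧ volume (K n) = 0 := by
    intro n
    have hn : K n ∈ insert ∅ (⋃ M ∈ 𝓢, 𝒦 M) := hK ▸ Set.mem_range_self n
    rcases hn with hn | hn
    · rw [hn]
      exact ⟨isCompact_empty, IsSqueezable.empty, measure_empty⟩
    · obtain ⟨M, hM, hn⟩ := Set.mem_iUnion₂.1 hn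
      exact h𝒦 M hM _ hn
  have hKcover : frontier A ⊆ ⋃ n, K n := by
    intro x hx
    obtain ⟨M, hM, hxM⟩ := hcover hx
    obtain ⟨L, hL, hxL⟩ := hM𝒦 M hM hxM
    have hLr : L ∈ Set.range K := hK ▸ Or.inr (Set.mem_biUnion hM hL)
    obtain ⟨n, rfl⟩ := hLr
    exact Set.mem_iUnion.2 ⟨n, hxL⟩
  have hnull : volume (frontier A) = 0 :=
    measure_mono_null hKcover (measure_iUnion_null fun n => (hKprop n).2.2)
  have hcomp : IsCompact (frontier A) :=
    hA.isCompact_closure.of_isClosed_subset isClosed_frontier frontier_subset_closure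
  have hsq : ∀ ε : ℝ, 0 < ε → ∃ f : EuclideanSpace ℝ (Fin d) → EuclideanSpace ℝ (Fin d),
      IsSqueeze f ∧ (∀ x, ‖f x - x‖ ≤ ε) ∧ IsPolyhedron (f '' A) := by
    intro ε hε
    obtain ⟨f, hf, hfd, hfl⟩ := IsSqueezable.exists_isSqueeze_isFlat_image hcomp
      (fun n => (hKprop n).2.1) (fun n => (hKprop n).1) hKcover hε
    exact ⟨f, hf, hfd, hf.isPolyhedron_image hA hfl⟩
  refine ⟨⟨hA, fun ε hε => ?_⟩, hA, nullMeasurableSet_of_null_frontier hnull, fun ε hε => ?_⟩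
  · obtain ⟨f, hf, hfd, hpoly⟩ := hsq ε hε
    refine ⟨A.domRestrict f, ?_, by rwa [Set.range_domRestrict], fun x => hfd x⟩
    simpa using! hf.1.comp (LipschitzWith.subtype_val A)
  · have hvol : volume A = volume (interior A) :=
      (measure_congr (interior_ae_eq_of_null_frontier hnull)).symm
    have hfin : volume (interior A) ≠ ⊤ := by
      rw [← hvol]
      exact hA.measure_lt_top.ne
    obtain ⟨Q, hQA, hQ, hQv⟩ : ∃ Q ⊆ interior A, IsCompact Q ∧
        volume (interior A) < volume Q + ENNReal.ofReal ε :=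
      isOpen_interior.measurableSet.exists_isCompact_lt_add hfin
        (ENNReal.ofReal_pos.2 hε).ne'
    obtain ⟨δ, hδ, hδA⟩ := hQ.exists_cthickening_subset_open isOpen_interior hQA
    obtain ⟨f, hf, hfd, hpoly⟩ := hsq δ hδ
    refine ⟨A.domRestrict f, ?_, by rwa [Set.range_domRestrict], ?_⟩
    · simpa using! hf.1.comp (LipschitzWith.subtype_val A)
    -- A preimage of `p ∈ Q` is within `δ` of `p`, hence in `A`.
    have hsub : Q ⊆ f '' A := by
      intro p hp
      obtain ⟨x, rfl⟩ := hf.2.1 p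
      refine ⟨x, interior_subset (hδA (Metric.mem_cthickening_of_dist_le _ _ _ _ hp ?_)), rfl⟩
      rw [dist_comm, dist_eq_norm]
      exact hfd x
    rw [hvol, Set.range_domRestrict]
    exact hQv.trans_le (by gcongr)
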